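/- For integers $1\le p\le n$ let $W_{p,n}$ be the probability measure on $\mathbb{R}^p$ with Lebesgue density $$\frac{1}{D_{p,n}}\prod_{1\le i<j\le p}|s_i^2-s_j^2|^2\prod_{i=1}^p s_i^{2(n-p)+1}\prod_{i=1}^p e^{-ns_i^2}\,\mathbf 1_{\{s_1,\dots,s_p\ge 0\}},$$ where $D_{p,n}\in(0,\infty)$ is the normalizing constant. Let $\mathcal M_1(\mathbb R_+)$ be the space of Borel probability measures on $\mathbb R_+=[0,\infty)$ with the weak topology, let $\hat\mu_p=\frac1p\sum_{i=1}^p\delta_{s_i}\in\mathcal M_1(\mathbb R_+)$, and for $\mu\in\mathcal M_1(\mathbb R_+)$ put $$J^+(\mu)=\int (x^2-\log x^2)\,d\mu(x)\in[1,\infty],$$ where the integrand is $+\infty$ at $x=0$. Let $n=n(p)\ge1$ be integers with $p/n(p)\to0$ as $p\to\infty$ (so that $p\le n(p)$ for all large $p$). Then $\hat\mu_p$ under the law $W_{p,n(p)}$ satisfies, as $p\to\infty$, a large deviation principle with speed $p\,n(p)$ and good rate function $$I^+(\mu)=J^+(\mu)-\inf_{\nu\in\mathcal M_1(\mathbb R_+)}J^+(\nu)=J^+(\mu)-1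 .$$ That is, $I^+:\mathcal M_1(\mathbb R_+)\to[0,\infty]$ is lower semicontinuous, the sets $\{I^+\le M\}$, $0\le M<\infty$, are compact, and $$\liminf_{p\to\infty}\frac{1}{p\,n(p)}\log W_{p,n(p)}(\hat\mu_p\in O)\ge-\inf_{O}I^+\quad\text{for every open } O\subset\mathcal M_1(\mathbb R_+),$$ $$\limsup_{p\to\infty}\frac{1}{p\,n(p)}\log W_{p,n(p)}(\hat\mu_p\in F)\le-\inf_{F}I^+\quad\text{for every closed } F\subset\mathcal M_1(\mathbb R_+).$$ Moreover $\delta_1$ is the unique minimizer of $J^+$ (equivalently of $I^+$), with $J^+(\delta_1)=1$. -/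

import Mathlib

open MeasureTheory Filter Topology
open scoped NNReal ENNReal

noncomputable section

namespace WishartLDP

/-- The unnormalized density of the singular values,
`∏_{i<j} |s_i² - s_j²|² ∏_i s_i^{2(n-p)+1} ∏_i exp (-n s_i²)` on `{s | ∀ i, 0 ≤ s_i}`, and `0`
elsewhere. The exponent `2(n-p)+1` is computed in `ℤ`. -/
def density (p n : ℕ) (s : Fin p → ℝ) : ℝ :=
  open Classical in
  if ∀ i, 0 ≤ s i then
    (∏ i : Fin p, ∏ j ∈ Finset.Ioi i, |s i ^ 2 - s j ^ 2| ^ 2)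
      * (∏ i : Fin p, s i ^ (2 * ((n : ℤ) - (p : ℤ)) + 1))
      * (∏ i : Fin p, Real.exp (-(n : ℝ) * s i ^ 2))
  else 0

/-- The normalizing constant `D_{p,n}`. -/
def normConst (p n : ℕ) : ℝ≥0∞ :=
  ∫⁻ s : Fin p → ℝ, ENNReal.ofReal (density p n s)

/-- The law `W_{p,n}` on `ℝ^p` with Lebesgue density `density p n / D_{p,n}`. -/
def law (p n : ℕ) : Measure (Fin p → ℝ) :=
  (normConst p n)⁻¹ •
    (volume : Measure (Fin p → ℝ)).withDensity (fun s => ENNReal.ofReal (density p n s))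

/-- The empirical measure `(1/p) ∑_i δ_{s_i}` as an element of the space of probability measures on
`ℝ₊ = [0, ∞)`. (The coordinates are nonnegative `law p n`-almost surely, so that `Real.toNNReal`
only records this.) -/
def empirical (p : ℕ+) (s : Fin p → ℝ) : ProbabilityMeasure ℝ≥0 :=
  ⟨((p : ℕ) : ℝ≥0∞)⁻¹ • ∑ i : Fin p, Measure.dirac (s i).toNNReal, ⟨by
    have h : ((p : ℕ) : ℝ≥0∞) ≠ 0 := by exact_mod_cast p.ne_zero
    simp [ENNReal.inv_mul_cancel h (ENNReal.natCast_ne_top _)]⟩⟩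

/-- The function `x ↦ x² - log x²` on `[0, ∞)`, with value `+∞` at `x = 0`. It is bounded below
by `1` (see `one_le_sq_sub_log_sq`), so nothing is lost by taking values in `[0, ∞]`. -/
def potential (x : ℝ≥0) : ℝ≥0∞ :=
  if x = 0 then ⊤ else ENNReal.ofReal ((x : ℝ) ^ 2 - Real.log ((x : ℝ) ^ 2))

theorem one_le_sq_sub_log_sq (x : ℝ) (hx : x ≠ 0) : 1 ≤ x ^ 2 - Real.log (x ^ 2) := by
  have h := Real.log_le_sub_one_of_pos (show (0 : ℝ) < x ^ 2 by positivity)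
  linarith

/-- `J⁺(μ) = ∫ (x² - log x²) dμ(x) ∈ [1, ∞]`. -/
def J (μ : ProbabilityMeasure ℝ≥0) : ℝ≥0∞ :=
  ∫⁻ x, potential x ∂(μ : Measure ℝ≥0)

/-- The normalized functional `μ ↦ J⁺(μ) - inf J⁺`, which has infimum zero. -/
def rate (μ : ProbabilityMeasure ℝ≥0) : ℝ≥0∞ :=
  J μ - ⨅ ν : ProbabilityMeasure ℝ≥0, J ν

/-- Large deviation principle, along the filter `l`, for the `E`-valued random elements
`X i` defined on `(Ω i, P i)`, with speed `a` and rate function `I : E → [0, ∞]`. The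
logarithm is the extended one, with `log 0 = -∞`. -/
structure SatisfiesLDP {ι : Type*} (l : Filter ι) {Ω : ι → Type*}
    [∀ i, MeasurableSpace (Ω i)] (P : ∀ i, Measure (Ω i))
    {E : Type*} [TopologicalSpace E] (X : ∀ i, Ω i → E) (a : ι → ℝ) (I : E → ℝ≥0∞) : Prop where
  speed : Tendsto a l atTop
  lowerSemicontinuous : LowerSemicontinuous I
  lower_bound : ∀ O : Set E, IsOpen O →
    -((⨅ x ∈ O, I x : ℝ≥0∞) : EReal) ≤
      liminf (fun i => ENNReal.log (P i (X i ⁻¹' O)) / ((a i : ℝ) : EReal)) l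
  upper_bound : ∀ F : Set E, IsClosed F →
    limsup (fun i => ENNReal.log (P i (X i ⁻¹' F)) / ((a i : ℝ) : EReal)) l ≤
      -((⨅ x ∈ F, I x : ℝ≥0∞) : EReal)

/-- Goodness of a rate function: all (finite) sublevel sets are compact. -/
def IsGood {E : Type*} [TopologicalSpace E] (I : E → ℝ≥0∞) : Prop :=
  ∀ M : ℝ≥0, IsCompact {x | I x ≤ (M : ℝ≥0∞)}

end WishartLDP

end

/-! Put V(x) = x² - log x². As e^{-V(x)} = x² e^{-x²}, the unnormalized density on the positive
orthant is exp(-n ∑ V(s_i)) = exp(-pn J(μ̂_p)), times the Vandermonde factor and the powers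
s_i^{1-2p}. The cost of these corrections, and of the Lebesgue volume of a small box, is at most of
order p² (log(n/p) + 1) + p log n, or a multiple p/n of the main term. All of this is o(pn) because
p/n → 0. Neither the repulsion nor any entropy survives, and the rate is the linear functional J
minus its minimum.

Upper bound: 30p of the n copies of V at each coordinate pay for the Vandermonde factor and leave a
Gaussian (`coordBound_le`). Hence any set of configurations with J(μ̂_p) ≥ c has mass at most
exp(-(n - 30p)pc) (`setLIntegral_density_le`), and no exponential tightness or covering argument is
needed.

Lower bound: if J(μ) is finite, a typical i.i.d. sample from μ has empirical measures converging to
μ and averages of V converging to J(μ) (`exists_seq_tendsto_empirical`). After sorting, a nearby box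
of separated configurations has sufficient mass (`ofReal_exp_lowerExponent_le`).

Applied with c = 1 and to the configuration of ones, the two estimates give log D_{p,n} ~ -pn, which
accounts for the subtracted 1. Goodness follows from monotone convergence, V ≥ x²/2 and Prokhorov's
theorem. -/

noncomputable section

namespace WishartLDP

/-! ### Elementary bounds on the potential -/

/-- The function `x ↦ x² - log x²`, real-valued. -/
def realPotential (x : ℝ) : ℝ := x ^ 2 - Real.log (x ^ 2)

theorem exp_neg_realPotential {x : ℝ} (hx : 0 < x) :
    Real.exp (-realPotential x) = x ^ 2 * Real.exp (-x ^ 2) := by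
  rw [realPotential, neg_sub, sub_eq_add_neg, Real.exp_add, Real.exp_log (by positivity)]

theorem one_le_realPotential {x : ℝ} (hx : 0 < x) : 1 ≤ realPotential x :=
  one_le_sq_sub_log_sq x hx.ne'

/-- For y = x² this yields log x² ≤ x²/2, so half of the quadratic term of the potential survives
the logarithm. -/
theorem le_exp_half (y : ℝ) : y ≤ Real.exp (y / 2) := by
  rcases le_or_gt y 0 with hy | hy
  · exact hy.trans (Real.exp_pos _).le
  · have h := Real.quadratic_le_exp_of_nonneg (x := y / 2) (by positivity)
    nlinarith [sq_nonneg (y / 2 - 1)]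

theorem sq_le_two_mul_realPotential {x : ℝ} (hx : 0 < x) : x ^ 2 ≤ 2 * realPotential x := by
  have h := Real.log_le_log (by positivity) (le_exp_half (x ^ 2))
  rw [Real.log_exp] at h
  unfold realPotential
  linarith

/-! ### Upper bounds on the density -/

/-- The bound for the contribution of a single coordinate to the density. -/
def coordBound (p n : ℕ) (x : ℝ) : ℝ :=
  (1 + x ^ 2) ^ (4 * p) * x ^ (2 * ((n : ℤ) - (p : ℤ)) + 1) * Real.exp (-(n : ℝ) * x ^ 2)

/-- Enlarging the product to all ordered pairs only adds factors at least 1. Each coordinate then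
occurs p times in each of two roles, always squared, whence the exponent 4p. -/
theorem prod_Ioi_abs_sq_sub_sq_le {p : ℕ} (s : Fin p → ℝ) :
    (∏ i : Fin p, ∏ j ∈ Finset.Ioi i, |s i ^ 2 - s j ^ 2| ^ 2) ≤
      ∏ i : Fin p, (1 + s i ^ 2) ^ (4 * p) := by
  have hone : ∀ i, 1 ≤ (1 + s i ^ 2) ^ 2 := fun i => one_le_pow₀ (by nlinarith [sq_nonneg (s i)])
  have hpair : ∀ i j, |s i ^ 2 - s j ^ 2| ^ 2 ≤ (1 + s i ^ 2) ^ 2 * (1 + s j ^ 2) ^ 2 := by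
    intro i j
    rw [← mul_pow]
    refine pow_le_pow_left₀ (abs_nonneg _) ?_ 2
    rw [abs_le]
    constructor <;> nlinarith [sq_nonneg (s i), sq_nonneg (s j), sq_nonneg (s i * s j)]
  calc (∏ i : Fin p, ∏ j ∈ Finset.Ioi i, |s i ^ 2 - s j ^ 2| ^ 2)
      ≤ ∏ i : Fin p, ∏ j : Fin p, ((1 + s i ^ 2) ^ 2 * (1 + s j ^ 2) ^ 2) := by
        refine Finset.prod_le_prod (fun i _ => Finset.prod_nonneg fun j _ => by positivity) ?_
        intro i _
        calc (∏ j ∈ Finset.Ioi i, |s i ^ 2 - s j ^ 2| ^ 2)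
            ≤ ∏ j ∈ Finset.Ioi i, ((1 + s i ^ 2) ^ 2 * (1 + s j ^ 2) ^ 2) :=
              Finset.prod_le_prod (fun j _ => by positivity) fun j _ => hpair i j
          _ ≤ ∏ j : Fin p, ((1 + s i ^ 2) ^ 2 * (1 + s j ^ 2) ^ 2) :=
              Finset.prod_le_prod_of_subset_of_one_le (Finset.subset_univ _)
                (fun j _ => by positivity) fun j _ _ => one_le_mul_of_one_le_of_one_le (hone i) (hone j)
    _ = ∏ i : Fin p, (1 + s i ^ 2) ^ (4 * p) := by
        simp only [Finset.prod_mul_distrib, Finset.prod_const, Finset.card_univ, Fintype.card_fin]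
        rw [← Finset.prod_pow, ← Finset.prod_mul_distrib]
        refine Finset.prod_congr rfl fun i _ => ?_
        rw [← pow_mul, ← pow_add]
        congr 1
        ring

theorem density_le_prod_coordBound {p n : ℕ} {s : Fin p → ℝ} (hs : ∀ i, 0 ≤ s i) :
    density p n s ≤ ∏ i, coordBound p n (s i) := by
  unfold density coordBound
  rw [if_pos hs, Finset.prod_mul_distrib, Finset.prod_mul_distrib]
  have h1 : 0 ≤ ∏ i : Fin p, s i ^ (2 * ((n : ℤ) - (p : ℤ)) + 1) :=
    Finset.prod_nonneg fun i _ => zpow_nonneg (hs i) _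
  have h2 : 0 ≤ ∏ i : Fin p, Real.exp (-(n : ℝ) * s i ^ 2) :=
    Finset.prod_nonneg fun i _ => (Real.exp_pos _).le
  exact mul_le_mul_of_nonneg_right
    (mul_le_mul_of_nonneg_right (prod_Ioi_abs_sq_sub_sq_le s) h1) h2

theorem density_eq_zero_of_not_pos {p n : ℕ} (hpn : p ≤ n) {s : Fin p → ℝ}
    (hs : ¬ ∀ i, 0 < s i) : density p n s = 0 := by
  unfold density
  split_ifs with h
  · push Not at hs
    obtain ⟨i, hi⟩ := hs
    have hz : s i = 0 := le_antisymm hi (h i)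
    have hprod : ∏ i : Fin p, s i ^ (2 * ((n : ℤ) - (p : ℤ)) + 1) = 0 :=
      Finset.prod_eq_zero (Finset.mem_univ i) (by rw [hz, zero_zpow]; omega)
    rw [hprod, mul_zero, zero_mul]
  · rfl

/-- With n = 30p + N, the N copies of x² e^{-x²} form the main term. What remains has exponent at
most (4p + 29p/2 + 1 - 30p) x², which is below -4x² since p ≥ 1. -/
theorem coordBound_le {p n : ℕ} (hp : 1 ≤ p) (hn : 30 * p ≤ n) {x : ℝ} (hx : 0 < x) :
    coordBound p n x ≤
      Real.exp (-(((n : ℝ) - 30 * p) * realPotential x)) * Real.exp (-4 * x ^ 2) := by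
  obtain ⟨N, rfl⟩ := Nat.exists_eq_add_of_le hn
  have hzpow : x ^ (2 * (((30 * p + N : ℕ) : ℤ) - (p : ℤ)) + 1) = (x ^ 2) ^ N * (x ^ 2) ^ (29 * p) * x := by
    rw [← pow_mul, ← pow_mul, ← pow_add, ← pow_succ, ← zpow_natCast]
    congr 1
    push_cast
    ring
  have hV : Real.exp (-((((30 * p + N : ℕ) : ℝ) - 30 * p) * realPotential x)) =
      (x ^ 2) ^ N * Real.exp (-(N * x ^ 2)) := by
    have : -((((30 * p + N : ℕ) : ℝ) - 30 * p) * realPotential x) = (N : ℝ) * (-realPotential x) := by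
      push_cast; ring
    rw [this, Real.exp_nat_mul, exp_neg_realPotential hx, mul_pow, ← Real.exp_nat_mul]
    congr 2
    ring
  have h1 : (1 + x ^ 2) ^ (4 * p) ≤ Real.exp (4 * p * x ^ 2) := by
    calc (1 + x ^ 2) ^ (4 * p) ≤ (Real.exp (x ^ 2)) ^ (4 * p) := by
          refine pow_le_pow_left₀ (by positivity) ?_ _
          linarith [Real.add_one_le_exp (x ^ 2)]
      _ = _ := by rw [← Real.exp_nat_mul]; push_cast; rfl
  have h2 : (x ^ 2) ^ (29 * p) ≤ Real.exp (29 * p * (x ^ 2 / 2)) := by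
    calc (x ^ 2) ^ (29 * p) ≤ (Real.exp (x ^ 2 / 2)) ^ (29 * p) :=
          pow_le_pow_left₀ (by positivity) (le_exp_half _) _
      _ = _ := by rw [← Real.exp_nat_mul]; push_cast; rfl
  have h3 : x ≤ Real.exp (x ^ 2) := by
    nlinarith [Real.add_one_le_exp (x ^ 2), sq_nonneg (x - 1)]
  have h4 : Real.exp (4 * p * x ^ 2) * Real.exp (29 * p * (x ^ 2 / 2)) * Real.exp (x ^ 2) *
      Real.exp (-(30 * p * x ^ 2)) ≤ Real.exp (-4 * x ^ 2) := by
    rw [← Real.exp_add, ← Real.exp_add, ← Real.exp_add]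
    refine Real.exp_le_exp.2 ?_
    have hp' : (1 : ℝ) ≤ p := by exact_mod_cast hp
    nlinarith [mul_le_mul_of_nonneg_right hp' (sq_nonneg x)]
  have h5 : Real.exp (-((30 * p + N : ℕ) : ℝ) * x ^ 2) =
      Real.exp (-(30 * p * x ^ 2)) * Real.exp (-(N * x ^ 2)) := by
    rw [← Real.exp_add]; congr 1; push_cast; ring
  unfold coordBound
  rw [hzpow, hV, h5]
  calc (1 + x ^ 2) ^ (4 * p) * ((x ^ 2) ^ N * (x ^ 2) ^ (29 * p) * x) *
        (Real.exp (-(30 * p * x ^ 2)) * Real.exp (-(N * x ^ 2)))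
      = ((x ^ 2) ^ N * Real.exp (-(N * x ^ 2))) *
        ((1 + x ^ 2) ^ (4 * p) * (x ^ 2) ^ (29 * p) * x * Real.exp (-(30 * p * x ^ 2))) := by ring
    _ ≤ ((x ^ 2) ^ N * Real.exp (-(N * x ^ 2))) *
        (Real.exp (4 * p * x ^ 2) * Real.exp (29 * p * (x ^ 2 / 2)) * Real.exp (x ^ 2) *
          Real.exp (-(30 * p * x ^ 2))) := by gcongr
    _ ≤ _ := mul_le_mul_of_nonneg_left h4 (by positivity)

/-- A cruder bound that covers every p ≤ n, used only for the finiteness of the normalizing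
constant: half of the Gaussian absorbs the polynomial. -/
theorem exists_coordBound_le {p n : ℕ} (hpn : p ≤ n) (hn : 1 ≤ n) :
    ∃ C : ℝ, 0 ≤ C ∧ ∀ x : ℝ, 0 < x → coordBound p n x ≤ C * Real.exp (-(1 / 2) * x ^ 2) := by
  obtain ⟨m, rfl⟩ := Nat.exists_eq_add_of_le hpn
  set k := 4 * p + (2 * m + 1) with hk
  refine ⟨2 ^ k * (k.factorial * Real.exp (1 / 2)), by positivity, fun x hx => ?_⟩
  have hzpow : x ^ (2 * (((p + m : ℕ) : ℤ) - (p : ℤ)) + 1) = x ^ (2 * m + 1) := by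
    rw [← zpow_natCast]
    congr 1
    push_cast
    ring
  have h1 : x ^ (2 * m + 1) ≤ (1 + x ^ 2) ^ (2 * m + 1) :=
    pow_le_pow_left₀ hx.le (by nlinarith [sq_nonneg (x - 1)]) _
  have h2 : (1 + x ^ 2) ^ k ≤ 2 ^ k * (k.factorial * Real.exp ((1 + x ^ 2) / 2)) := by
    have h := Real.pow_div_factorial_le_exp (x := (1 + x ^ 2) / 2) (by positivity) k
    rw [div_le_iff₀ (by positivity), div_pow, div_le_iff₀ (by positivity)] at h
    linarith
  have h3 : Real.exp (-((p + m : ℕ) : ℝ) * x ^ 2) ≤ Real.exp (-x ^ 2) := by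
    refine Real.exp_le_exp.2 ?_
    have hn' : (1 : ℝ) ≤ ((p + m : ℕ) : ℝ) := by exact_mod_cast hn
    nlinarith [mul_le_mul_of_nonneg_right hn' (sq_nonneg x)]
  unfold coordBound
  rw [hzpow]
  calc (1 + x ^ 2) ^ (4 * p) * x ^ (2 * m + 1) * Real.exp (-((p + m : ℕ) : ℝ) * x ^ 2)
      ≤ (1 + x ^ 2) ^ (4 * p) * (1 + x ^ 2) ^ (2 * m + 1) * Real.exp (-x ^ 2) := by gcongr
    _ = (1 + x ^ 2) ^ k * Real.exp (-x ^ 2) := by rw [← pow_add]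
    _ ≤ 2 ^ k * (k.factorial * Real.exp ((1 + x ^ 2) / 2)) * Real.exp (-x ^ 2) := by gcongr
    _ = 2 ^ k * (k.factorial * Real.exp (1 / 2)) * Real.exp (-(1 / 2) * x ^ 2) := by
        have h4 : Real.exp ((1 + x ^ 2) / 2) * Real.exp (-x ^ 2) =
            Real.exp (1 / 2) * Real.exp (-(1 / 2) * x ^ 2) := by
          rw [← Real.exp_add, ← Real.exp_add]
          congr 1
          ring
        linear_combination (2 ^ k * (k.factorial : ℝ)) * h4

theorem lintegral_prod_exp_neg_mul_sq (p : ℕ) {b : ℝ} (hb : 0 < b) :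
    ∫⁻ s : Fin p → ℝ, ENNReal.ofReal (∏ i, Real.exp (-b * s i ^ 2)) =
      ENNReal.ofReal (√(Real.pi / b) ^ p) := by
  rw [← ofReal_integral_eq_lintegral_ofReal]
  · rw [integral_fintype_prod_volume_eq_pow (fun x : ℝ => Real.exp (-b * x ^ 2)),
      integral_gaussian, Fintype.card_fin]
  · exact Integrable.fintype_prod (f := fun _ x => Real.exp (-b * x ^ 2))
      fun _ => integrable_exp_neg_mul_sq hb
  · exact ae_of_all _ fun s => Finset.prod_nonneg fun i _ => (Real.exp_pos _).le

theorem normConst_ne_top {p n : ℕ} (hpn : p ≤ n) (hn : 1 ≤ n) : normConst p n ≠ ⊤ := by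
  obtain ⟨C, hC, h⟩ := exists_coordBound_le hpn hn
  refine ne_top_of_le_ne_top ?_ (lintegral_mono (g := fun s =>
    ENNReal.ofReal (C ^ p) * ENNReal.ofReal (∏ i, Real.exp (-(1 / 2) * s i ^ 2))) fun s => ?_)
  · rw [lintegral_const_mul' _ _ ENNReal.ofReal_ne_top,
      lintegral_prod_exp_neg_mul_sq p (by norm_num)]
    exact ENNReal.mul_ne_top ENNReal.ofReal_ne_top ENNReal.ofReal_ne_top
  · by_cases hs : ∀ i, 0 < s i
    · beta_reduce
      rw [← ENNReal.ofReal_mul (by positivity)]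
      refine ENNReal.ofReal_le_ofReal ((density_le_prod_coordBound fun i => (hs i).le).trans ?_)
      calc ∏ i, coordBound p n (s i) ≤ ∏ i, (C * Real.exp (-(1 / 2) * s i ^ 2)) := by
            refine Finset.prod_le_prod (fun i _ => ?_) fun i _ => h _ (hs i)
            have := zpow_pos (hs i) (2 * ((n : ℤ) - (p : ℤ)) + 1)
            unfold coordBound
            positivity
        _ = _ := by simp [Finset.prod_mul_distrib]
    · simp [density_eq_zero_of_not_pos hpn hs]

theorem density_le_exp_mul_prod {p n : ℕ} (hp : 1 ≤ p) (hn : 30 * p ≤ n) {c : ℝ}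
    {s : Fin p → ℝ} (hs : (∀ i, 0 < s i) → c ≤ ∑ i, realPotential (s i)) :
    density p n s ≤ Real.exp (-(((n : ℝ) - 30 * p) * c)) * ∏ i, Real.exp (-4 * s i ^ 2) := by
  have hnp : (0 : ℝ) ≤ (n : ℝ) - 30 * p := by
    rw [sub_nonneg]; exact_mod_cast hn
  have hprod : 0 ≤ ∏ i, Real.exp (-4 * s i ^ 2) := Finset.prod_nonneg fun i _ => (Real.exp_pos _).le
  by_cases hpos : ∀ i, 0 < s i
  · calc density p n s ≤ ∏ i, coordBound p n (s i) :=
          density_le_prod_coordBound fun i => (hpos i).le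
      _ ≤ ∏ i, (Real.exp (-(((n : ℝ) - 30 * p) * realPotential (s i))) *
            Real.exp (-4 * s i ^ 2)) := by
          refine Finset.prod_le_prod (fun i _ => ?_) fun i _ => coordBound_le hp hn (hpos i)
          have := zpow_pos (hpos i) (2 * ((n : ℤ) - (p : ℤ)) + 1)
          unfold coordBound
          positivity
      _ = Real.exp (-(((n : ℝ) - 30 * p) * ∑ i, realPotential (s i))) *
            ∏ i, Real.exp (-4 * s i ^ 2) := by
          rw [Finset.prod_mul_distrib, ← Real.exp_sum, Finset.sum_neg_distrib, Finset.mul_sum]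
      _ ≤ _ := mul_le_mul_of_nonneg_right
          (Real.exp_le_exp.2 (neg_le_neg (mul_le_mul_of_nonneg_left (hs hpos) hnp))) hprod
  · rw [density_eq_zero_of_not_pos (by omega) hpos]
    exact mul_nonneg (Real.exp_pos _).le hprod

theorem measurableSet_le_sum_realPotential (p : ℕ) (c : ℝ) :
    MeasurableSet {s : Fin p → ℝ | (∀ i, 0 < s i) → c ≤ ∑ i, realPotential (s i)} := by
  have h1 : MeasurableSet {s : Fin p → ℝ | ∀ i, 0 < s i} := by
    simp only [Set.ofPred_forall]
    exact MeasurableSet.iInter fun i => measurableSet_lt measurable_const (measurable_pi_apply i)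
  have h2 : MeasurableSet {s : Fin p → ℝ | c ≤ ∑ i, realPotential (s i)} := by
    refine measurableSet_le measurable_const (Finset.measurable_sum _ fun i _ => ?_)
    unfold realPotential
    fun_prop
  exact h1.imp h2

/-- An upper bound for the unnormalized mass of a set of configurations on which the sum of
the potential is at least `c`. -/
theorem setLIntegral_density_le {p n : ℕ} (hp : 1 ≤ p) (hn : 30 * p ≤ n) (c : ℝ)
    (A : Set (Fin p → ℝ)) (hA : ∀ s ∈ A, (∀ i, 0 < s i) → c ≤ ∑ i, realPotential (s i)) :
    ∫⁻ s in A, ENNReal.ofReal (density p n s) ≤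
      ENNReal.ofReal (Real.exp (-(((n : ℝ) - 30 * p) * c))) := by
  -- The leftover Gaussian e^{-4x²} has mass at most 1 per coordinate because π ≤ 4.
  have hsqrt : √(Real.pi / 4) ^ p ≤ 1 := by
    refine pow_le_one₀ (Real.sqrt_nonneg _) ?_
    rw [Real.sqrt_le_one]
    linarith [Real.pi_le_four]
  generalize ha : Real.exp (-(((n : ℝ) - 30 * p) * c)) = a
  have ha0 : 0 ≤ a := ha ▸ (Real.exp_pos _).le
  -- `A` is arbitrary; the pointwise bound is integrated over the measurable superset `B`.
  set B : Set (Fin p → ℝ) := {s | (∀ i, 0 < s i) → c ≤ ∑ i, realPotential (s i)}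
  have hAB : A ⊆ B := hA
  have h2 : ∫⁻ s in B, ENNReal.ofReal (density p n s) ≤ ∫⁻ s in B, ENNReal.ofReal a *
        ENNReal.ofReal (∏ i : Fin p, Real.exp (-4 * s i ^ 2)) := by
    refine setLIntegral_mono' (measurableSet_le_sum_realPotential p c) fun s hs => ?_
    rw [← ENNReal.ofReal_mul ha0, ← ha]
    exact ENNReal.ofReal_le_ofReal (density_le_exp_mul_prod hp hn hs)
  refine (lintegral_mono_set hAB).trans (h2.trans ((setLIntegral_le_lintegral _ _).trans ?_))
  rw [lintegral_const_mul' _ _ ENNReal.ofReal_ne_top, lintegral_prod_exp_neg_mul_sq p (by norm_num)]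
  exact mul_le_of_le_one_right' (ENNReal.ofReal_le_one.2 hsqrt)

/-! ### Lower bounds on the mass near a configuration -/

/-- Moving to the right only decreases -log x², so the singularity at 0 does no harm and the
increase is at most 2tη + η². The bounds 2t ≤ 1 + t² ≤ 3V(t) and η ≤ 2 ≤ 2V(t) make the error
relative, uniformly in t. -/
theorem realPotential_le_of_le_of_le_add {t x η : ℝ} (ht : 0 < t) (htx : t ≤ x) (hx : x ≤ t + η)
    (hη : η ≤ 2) : realPotential x ≤ (1 + 5 * η) * realPotential t := by
  have hη0 : 0 ≤ η := by linarith
  have hlog : Real.log (t ^ 2) ≤ Real.log (x ^ 2) := Real.log_le_log (by positivity) (by gcongr)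
  have h1 := one_le_realPotential ht
  have h2 := sq_le_two_mul_realPotential ht
  have h3 : x ^ 2 ≤ (t + η) ^ 2 := pow_le_pow_left₀ (ht.le.trans htx) hx 2
  have h4 : realPotential x ≤ realPotential t + (2 * t * η + η ^ 2) := by
    unfold realPotential
    nlinarith
  have h5 : 2 * t * η ≤ 3 * realPotential t * η := by
    refine mul_le_mul_of_nonneg_right ?_ hη0
    nlinarith [sq_nonneg (t - 1)]
  have h6 : η ^ 2 ≤ 2 * η * realPotential t := by nlinarith
  linarith

theorem exp_neg_mul_realPotential_le {p n : ℕ} (hp : 1 ≤ p) {x : ℝ} (hx : 0 < x) :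
    Real.exp (-(((n : ℝ) + 2 * p) * realPotential x)) ≤
      x ^ (2 * ((n : ℤ) - (p : ℤ)) + 1) * Real.exp (-(n : ℝ) * x ^ 2) := by
  rw [← Real.exp_log (zpow_pos hx (2 * ((n : ℤ) - (p : ℤ)) + 1)), ← Real.exp_add, Real.exp_le_exp,
    Real.log_zpow]
  have h1 := sq_le_two_mul_realPotential hx
  have hp' : (1 : ℝ) ≤ p := by exact_mod_cast hp
  have h2 : Real.log (x ^ 2) = 2 * Real.log x := by rw [Real.log_pow]; norm_num
  have h3 : 2 * Real.log x ≤ realPotential x := by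
    have h := Real.log_le_log (by positivity) (le_exp_half (x ^ 2))
    rw [Real.log_exp, h2] at h
    linarith
  have h4 := one_le_realPotential hx
  have h5 : ((p : ℝ) - 1 / 2) * (2 * Real.log x) ≤ (2 * p) * realPotential x := by
    calc ((p : ℝ) - 1 / 2) * (2 * Real.log x) ≤ ((p : ℝ) - 1 / 2) * realPotential x :=
          mul_le_mul_of_nonneg_left h3 (by linarith)
      _ ≤ _ := mul_le_mul_of_nonneg_right (by linarith) (by linarith)
  have h6 : (n : ℝ) * realPotential x = n * x ^ 2 - n * (2 * Real.log x) := by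
    rw [realPotential, h2]; ring
  push_cast
  linarith

/-- This is p! ≥ (p/e)^p, read off from one term of the series of e^p. Keeping n/p inside the
logarithm, rather than n, is what makes the Vandermonde cost o(pn). -/
theorem exp_neg_le_factorial_div_pow {p n : ℕ} (hp : 1 ≤ p) (hn : 1 ≤ n) :
    Real.exp (-(p * (Real.log (n / p) + 1))) ≤ ∏ k ∈ Finset.Icc 1 p, ((k : ℝ) / n) := by
  have hp' : (0 : ℝ) < p := by exact_mod_cast hp
  have hn' : (0 : ℝ) < n := by exact_mod_cast hn
  have h := Real.pow_div_factorial_le_exp (x := p) hp'.le p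
  have h1 : ∏ k ∈ Finset.Icc 1 p, ((k : ℝ) / n) = p.factorial / (n : ℝ) ^ p := by
    rw [Finset.prod_div_distrib, ← Nat.cast_prod, ← Finset.Ico_add_one_right_eq_Icc,
      Finset.prod_Ico_id_eq_factorial,
      Finset.prod_const, Nat.card_Ico, Nat.add_sub_cancel]
  have h2 : Real.exp (-(p * (Real.log (n / p) + 1))) = ((p : ℝ) / n) ^ p / Real.exp p := by
    have : -(p * (Real.log ((n : ℝ) / p) + 1)) = p * Real.log (p / n) - p := by
      rw [Real.log_div hn'.ne' hp'.ne', Real.log_div hp'.ne' hn'.ne']; ring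
    rw [this, Real.exp_sub, Real.exp_nat_mul, Real.exp_log (by positivity)]
  rw [h1, h2, div_pow, div_div, div_le_div_iff₀ (by positivity) (by positivity)]
  rw [div_le_iff₀ (by positivity)] at h
  calc (p : ℝ) ^ p * n ^ p ≤ (Real.exp p * p.factorial) * n ^ p := by gcongr
    _ = _ := by ring

/-- The differences j - i are distinct members of {1, …, p}, and the missing factors k/n are at most
1. -/
theorem prod_Icc_le_prod_Ioi {p n : ℕ} (hpn : p ≤ n) (i : Fin p) :
    ∏ k ∈ Finset.Icc 1 p, ((k : ℝ) / n) ≤ ∏ j ∈ Finset.Ioi i, ((((j : ℕ) : ℝ) - ((i : ℕ) : ℝ)) / n) := by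
  have hinj : Set.InjOn (fun j : Fin p => (j : ℕ) - (i : ℕ)) (Finset.Ioi i : Finset (Fin p)) := by
    intro a ha b hb hab
    simp only [Finset.coe_Ioi, Set.mem_Ioi, Fin.lt_def] at ha hb
    simp only at hab
    ext
    omega
  have himage : ∏ j ∈ Finset.Ioi i, ((((j : ℕ) : ℝ) - ((i : ℕ) : ℝ)) / n) =
      ∏ k ∈ (Finset.Ioi i).image (fun j : Fin p => (j : ℕ) - (i : ℕ)), ((k : ℝ) / n) := by
    rw [Finset.prod_image hinj]
    refine Finset.prod_congr rfl fun j hj => ?_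
    rw [Finset.mem_Ioi, Fin.lt_def] at hj
    rw [Nat.cast_sub hj.le]
  have hsub : (Finset.Ioi i).image (fun j : Fin p => (j : ℕ) - (i : ℕ)) ⊆ Finset.Icc 1 p := by
    intro k hk
    simp only [Finset.mem_image, Finset.mem_Ioi, Fin.lt_def] at hk
    obtain ⟨j, hj, rfl⟩ := hk
    rw [Finset.mem_Icc]
    have := j.2
    omega
  rw [himage, ← Finset.prod_sdiff hsub]
  refine mul_le_of_le_one_left (Finset.prod_nonneg fun k _ => by positivity)
    (Finset.prod_le_one (fun k _ => by positivity) fun k hk => ?_)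
  have hk' : k ≤ p := (Finset.mem_Icc.1 (Finset.mem_sdiff.1 hk).1).2
  exact div_le_one_of_le₀ (by exact_mod_cast hk'.trans hpn) (by positivity)

/-- A box of volume `n⁻ᵖ` close to `t` whose points have well separated coordinates if `t` is
monotone. -/
def separatedBox (n : ℕ) {p : ℕ} (t : Fin p → ℝ) : Set (Fin p → ℝ) :=
  Set.Icc (fun i => t i + 2 * ((i : ℕ) : ℝ) / n) (fun i => t i + (2 * ((i : ℕ) : ℝ) + 1) / n)

theorem volume_separatedBox (n : ℕ) {p : ℕ} (t : Fin p → ℝ) :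
    volume (separatedBox n t) = ENNReal.ofReal ((1 / (n : ℝ)) ^ p) := by
  rw [separatedBox, Real.volume_Icc_pi, ENNReal.ofReal_pow (by positivity)]
  have : ∀ i : Fin p, t i + (2 * ((i : ℕ) : ℝ) + 1) / n - (t i + 2 * ((i : ℕ) : ℝ) / n) = 1 / n :=
    fun i => by ring
  simp [this]

theorem le_of_mem_separatedBox {n p : ℕ} {t s : Fin p → ℝ} (hs : s ∈ separatedBox n t)
    (i : Fin p) : t i ≤ s i :=
  le_trans (le_add_of_nonneg_right (by positivity)) (hs.1 i)

theorem le_add_of_mem_separatedBox {n p : ℕ} {t s : Fin p → ℝ} (hs : s ∈ separatedBox n t)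
    (i : Fin p) : s i ≤ t i + 2 * p / n := by
  refine (hs.2 i).trans ?_
  have : ((i : ℕ) : ℝ) + 1 ≤ p := by exact_mod_cast i.2
  have h2 : (2 * ((i : ℕ) : ℝ) + 1) / n ≤ 2 * p / n :=
    div_le_div_of_nonneg_right (by linarith) (by positivity)
  linarith

theorem exp_neg_le_vandermonde {p n : ℕ} (hp : 1 ≤ p) (hpn : p ≤ n) {t s : Fin p → ℝ}
    (ht : ∀ i, 0 < t i) (hmono : Monotone t) (hs : s ∈ separatedBox n t) :
    Real.exp (-(4 * (p : ℝ) ^ 2 * (Real.log (n / p) + 1))) ≤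
      ∏ i : Fin p, ∏ j ∈ Finset.Ioi i, |s i ^ 2 - s j ^ 2| ^ 2 := by
  have hpos : ∀ i, 0 < s i := fun i => (ht i).trans_le (le_of_mem_separatedBox hs i)
  have hn : (0 : ℝ) < n := by exact_mod_cast hp.trans hpn
  have hpair : ∀ i : Fin p, ∀ j ∈ Finset.Ioi i, ((((j : ℕ) : ℝ) - ((i : ℕ) : ℝ)) / n) ^ 4 ≤ |s i ^ 2 - s j ^ 2| ^ 2 := by
    intro i j hij
    rw [Finset.mem_Ioi] at hij
    have h1 : ((i : ℕ) : ℝ) + 1 ≤ ((j : ℕ) : ℝ) := by exact_mod_cast hij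
    have h2 : (((j : ℕ) : ℝ) - ((i : ℕ) : ℝ)) / n ≤ s j - s i := by
      -- The box leaves a gap of (2(j - i) - 1)/n, at least (j - i)/n because j - i ≥ 1.
      have h3 : (((j : ℕ) : ℝ) - ((i : ℕ) : ℝ)) / n ≤ 2 * ((j : ℕ) : ℝ) / n - (2 * ((i : ℕ) : ℝ) + 1) / n := by
        rw [← sub_div]
        exact div_le_div_of_nonneg_right (by linarith) hn.le
      linarith [hs.1 j, hs.2 i, hmono hij.le]
    have h4 : 0 ≤ (((j : ℕ) : ℝ) - ((i : ℕ) : ℝ)) / n := div_nonneg (by linarith) hn.le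
    -- For positive coordinates s_j + s_i ≥ s_j - s_i, so the difference of squares dominates the
    -- squared gap.
    have h5 : ((((j : ℕ) : ℝ) - ((i : ℕ) : ℝ)) / n) ^ 2 ≤ |s i ^ 2 - s j ^ 2| := by
      rw [abs_sub_comm]
      refine le_trans ?_ (le_abs_self _)
      nlinarith [hpos i, hpos j]
    calc ((((j : ℕ) : ℝ) - ((i : ℕ) : ℝ)) / n) ^ 4 = (((((j : ℕ) : ℝ) - ((i : ℕ) : ℝ)) / n) ^ 2) ^ 2 := by ring
      _ ≤ _ := by gcongr
  calc Real.exp (-(4 * (p : ℝ) ^ 2 * (Real.log (n / p) + 1)))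
      = ∏ _i : Fin p, (Real.exp (-(p * (Real.log (n / p) + 1)))) ^ 4 := by
        rw [Finset.prod_const, Finset.card_univ, Fintype.card_fin, ← pow_mul, ← Real.exp_nat_mul]
        congr 1
        push_cast
        ring
    _ ≤ ∏ i : Fin p, ∏ j ∈ Finset.Ioi i, |s i ^ 2 - s j ^ 2| ^ 2 := by
        refine Finset.prod_le_prod (fun i _ => by positivity) fun i _ => ?_
        calc (Real.exp (-(p * (Real.log (n / p) + 1)))) ^ 4
            ≤ (∏ j ∈ Finset.Ioi i, ((((j : ℕ) : ℝ) - ((i : ℕ) : ℝ)) / n)) ^ 4 := by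
              gcongr
              exact (exp_neg_le_factorial_div_pow hp (hp.trans hpn)).trans
                (prod_Icc_le_prod_Ioi hpn i)
          _ = ∏ j ∈ Finset.Ioi i, ((((j : ℕ) : ℝ) - ((i : ℕ) : ℝ)) / n) ^ 4 := (Finset.prod_pow _ _ _).symm
          _ ≤ _ := Finset.prod_le_prod (fun j _ => by positivity) (hpair i)

/-- The logarithm of a lower bound for the unnormalized mass of a neighbourhood of a configuration
whose potential sums to `S`. -/
def lowerExponent (p n : ℕ) (S : ℝ) : ℝ :=
  -(p * Real.log n) - 4 * (p : ℝ) ^ 2 * (Real.log (n / p) + 1) -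
    ((n : ℝ) + 2 * p) * ((1 + 10 * p / n) * S)

theorem exp_le_density {p n : ℕ} (hp : 1 ≤ p) (hpn : p ≤ n) {t s : Fin p → ℝ}
    (ht : ∀ i, 0 < t i) (hmono : Monotone t) (hs : s ∈ separatedBox n t) :
    Real.exp (-(4 * (p : ℝ) ^ 2 * (Real.log (n / p) + 1))) *
      Real.exp (-(((n : ℝ) + 2 * p) * ((1 + 10 * p / n) * ∑ i, realPotential (t i)))) ≤
      density p n s := by
  have hpos : ∀ i, 0 < s i := fun i => (ht i).trans_le (le_of_mem_separatedBox hs i)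
  have hn : (0 : ℝ) < n := by exact_mod_cast hp.trans hpn
  have hη : 2 * (p : ℝ) / n ≤ 2 := by
    rw [div_le_iff₀ hn]
    have : (p : ℝ) ≤ n := by exact_mod_cast hpn
    linarith
  have hV : ∀ i, realPotential (s i) ≤ (1 + 10 * p / n) * realPotential (t i) := by
    intro i
    have h := realPotential_le_of_le_of_le_add (ht i) (le_of_mem_separatedBox hs i)
      (le_add_of_mem_separatedBox hs i) hη
    convert h using 2
    ring
  have hcoord : Real.exp (-(((n : ℝ) + 2 * p) * ((1 + 10 * p / n) * ∑ i, realPotential (t i)))) ≤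
      (∏ i : Fin p, s i ^ (2 * ((n : ℤ) - (p : ℤ)) + 1)) *
        ∏ i : Fin p, Real.exp (-(n : ℝ) * s i ^ 2) := by
    rw [← Finset.prod_mul_distrib, Finset.mul_sum, Finset.mul_sum, ← Finset.sum_neg_distrib,
      Real.exp_sum]
    refine Finset.prod_le_prod (fun i _ => (Real.exp_pos _).le) fun i _ => ?_
    refine le_trans ?_ (exp_neg_mul_realPotential_le hp (hpos i))
    refine Real.exp_le_exp.2 (neg_le_neg ?_)
    exact mul_le_mul_of_nonneg_left (hV i) (by positivity)
  unfold density
  rw [if_pos fun i => (hpos i).le, mul_assoc (∏ i : Fin p, ∏ j ∈ Finset.Ioi i, |s i ^ 2 - s j ^ 2| ^ 2)]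
  exact mul_le_mul (exp_neg_le_vandermonde hp hpn ht hmono hs) hcoord (Real.exp_pos _).le
    (Finset.prod_nonneg fun i _ => Finset.prod_nonneg fun j _ => by positivity)

theorem ofReal_exp_lowerExponent_le {p n : ℕ} (hp : 1 ≤ p) (hpn : p ≤ n) {t : Fin p → ℝ}
    (ht : ∀ i, 0 < t i) (hmono : Monotone t) :
    ENNReal.ofReal (Real.exp (lowerExponent p n (∑ i, realPotential (t i)))) ≤
      ∫⁻ s in separatedBox n t, ENNReal.ofReal (density p n s) := by
  have hn : (0 : ℝ) < n := by exact_mod_cast hp.trans hpn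
  have hm : MeasurableSet (separatedBox n t) := measurableSet_Icc
  refine le_trans (le_of_eq ?_) (setLIntegral_mono' hm fun s hs =>
    ENNReal.ofReal_le_ofReal (exp_le_density hp hpn ht hmono hs))
  rw [setLIntegral_const, volume_separatedBox, ← ENNReal.ofReal_mul (by positivity)]
  congr 1
  have h1 : (1 / (n : ℝ)) ^ p = Real.exp (-(p * Real.log n)) := by
    rw [← mul_neg, Real.exp_nat_mul, Real.exp_neg, Real.exp_log hn, one_div]
  rw [h1, ← Real.exp_add, ← Real.exp_add, lowerExponent]
  congr 1
  ring

/-- The constant configuration 1 sits at the minimum of the potential; the shifts in the box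
separate its coordinates. -/
theorem ofReal_exp_lowerExponent_le_normConst {p n : ℕ} (hp : 1 ≤ p) (hpn : p ≤ n) :
    ENNReal.ofReal (Real.exp (lowerExponent p n p)) ≤ normConst p n := by
  have h := ofReal_exp_lowerExponent_le hp hpn (t := fun _ => 1) (fun _ => one_pos)
    (fun _ _ _ => le_rfl)
  have hV : ∑ _i : Fin p, realPotential 1 = p := by simp [realPotential]
  rw [hV] at h
  exact h.trans (setLIntegral_le_lintegral _ _)

theorem normConst_ne_zero {p n : ℕ} (hp : 1 ≤ p) (hpn : p ≤ n) : normConst p n ≠ 0 := fun h =>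
  absurd (ofReal_exp_lowerExponent_le_normConst hp hpn) (by simp [h, Real.exp_pos])

theorem isProbabilityMeasure_law {p n : ℕ} (hp : 1 ≤ p) (hpn : p ≤ n) :
    IsProbabilityMeasure (law p n) := by
  refine ⟨?_⟩
  rw [law, Measure.smul_apply, withDensity_apply _ MeasurableSet.univ, setLIntegral_univ,
    smul_eq_mul]
  exact ENNReal.inv_mul_cancel (normConst_ne_zero hp hpn) (normConst_ne_top hpn (hp.trans hpn))

theorem law_apply (p n : ℕ) (A : Set (Fin p → ℝ)) :
    law p n A = (normConst p n)⁻¹ * ∫⁻ s in A, ENNReal.ofReal (density p n s) := by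
  rw [law, Measure.smul_apply, withDensity_apply', smul_eq_mul]

/-! ### The functional J and the rate function -/

theorem potential_of_pos {x : ℝ≥0} (hx : 0 < x) :
    potential x = ENNReal.ofReal (realPotential x) := by
  rw [potential, if_neg hx.ne', realPotential]

theorem one_le_potential (x : ℝ≥0) : 1 ≤ potential x := by
  rcases eq_or_ne x 0 with rfl | hx
  · simp [potential]
  · rw [potential_of_pos (pos_iff_ne_zero.2 hx), ENNReal.one_le_ofReal]
    exact one_le_realPotential (by exact_mod_cast pos_iff_ne_zero.2 hx)

theorem potential_one : potential 1 = 1 := by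
  simp [potential]

theorem eq_one_of_potential_le_one {x : ℝ≥0} (h : potential x ≤ 1) : x = 1 := by
  rcases eq_or_ne x 0 with rfl | hx
  · simp [potential] at h
  · have hpos : (0 : ℝ) < x := by exact_mod_cast pos_iff_ne_zero.2 hx
    rw [potential_of_pos (pos_iff_ne_zero.2 hx), ENNReal.ofReal_le_one] at h
    by_contra hne
    have hsq : (x : ℝ) ^ 2 ≠ 1 := by
      rw [Ne, pow_eq_one_iff_of_nonneg hpos.le two_ne_zero]
      exact_mod_cast hne
    have := Real.log_lt_sub_one_of_pos (show (0 : ℝ) < (x : ℝ) ^ 2 by positivity) hsq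
    unfold realPotential at h
    linarith

/-- The potential is -log(x² e^{-x²}) with the extended logarithm, so continuity at 0, where the
value is ∞, needs no separate argument. -/
theorem continuous_potential : Continuous potential := by
  have h : potential = fun x : ℝ≥0 =>
      (-(ENNReal.log (ENNReal.ofReal ((x : ℝ) ^ 2 * Real.exp (-(x : ℝ) ^ 2))))).toENNReal := by
    ext x
    rcases eq_or_ne x 0 with rfl | hx
    · simp [potential]
    · have hpos : (0 : ℝ) < x := by exact_mod_cast pos_iff_ne_zero.2 hx
      rw [potential_of_pos (pos_iff_ne_zero.2 hx), ← exp_neg_realPotential hpos,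
        ENNReal.log_ofReal_of_pos (Real.exp_pos _), Real.log_exp, ← EReal.coe_neg, neg_neg,
        EReal.toENNReal_of_ne_top (EReal.coe_ne_top _), EReal.toReal_coe]
  rw [h]
  refine EReal.continuous_toENNReal.comp (continuous_neg.comp
    (ENNReal.continuous_log.comp (ENNReal.continuous_ofReal.comp ?_)))
  fun_prop

/-- The truncation of the potential at height `k`, a bounded continuous function. -/
def truncatedPotential (k : ℕ) : BoundedContinuousFunction ℝ≥0 ℝ≥0 :=
  BoundedContinuousFunction.mkOfBound
    ⟨fun x => (min (potential x) k).toNNReal, by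
      refine continuous_iff_continuousAt.2 fun x => ?_
      have hx : min (potential x) (k : ℝ≥0∞) ≠ ⊤ :=
        ne_top_of_le_ne_top (ENNReal.natCast_ne_top k) (min_le_right _ _)
      exact (ENNReal.tendsto_toNNReal hx).comp
        (continuous_potential.min continuous_const).continuousAt⟩ k (by
    have h : ∀ x, (min (potential x) (k : ℝ≥0∞)).toNNReal ≤ k := fun x => by
      have := ENNReal.toNNReal_mono (ENNReal.natCast_ne_top k) (min_le_right (potential x) k)
      simpa using this
    intro x y
    rw [NNReal.dist_eq, abs_sub_le_iff]
    have h1 : (((min (potential x) (k : ℝ≥0∞)).toNNReal : ℝ≥0) : ℝ) ≤ k := by exact_mod_cast h x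
    have h2 : (((min (potential y) (k : ℝ≥0∞)).toNNReal : ℝ≥0) : ℝ) ≤ k := by exact_mod_cast h y
    constructor
    · exact (sub_le_self _ (NNReal.coe_nonneg _)).trans h1
    · exact (sub_le_self _ (NNReal.coe_nonneg _)).trans h2)

theorem coe_truncatedPotential (k : ℕ) (x : ℝ≥0) :
    (truncatedPotential k x : ℝ≥0∞) = min (potential x) k :=
  ENNReal.coe_toNNReal (ne_top_of_le_ne_top (ENNReal.natCast_ne_top k) (min_le_right _ _))

/-- Monotone convergence. It exhibits J as a supremum of weakly continuous functionals, hence as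
lower semicontinuous. -/
theorem J_eq_iSup (μ : ProbabilityMeasure ℝ≥0) :
    J μ = ⨆ k : ℕ, ∫⁻ x, truncatedPotential k x ∂(μ : Measure ℝ≥0) := by
  rw [← lintegral_iSup]
  · refine lintegral_congr fun x => ?_
    simp only [coe_truncatedPotential]
    rw [← inf_iSup_eq, ENNReal.iSup_natCast, inf_top_eq]
  · exact fun k => (truncatedPotential k).continuous.measurable.coe_nnreal_ennreal
  · intro k l hkl x
    simp only [coe_truncatedPotential]
    exact min_le_min_left _ (by exact_mod_cast hkl)

theorem lowerSemicontinuous_J : LowerSemicontinuous J := by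
  have h : J = fun μ : ProbabilityMeasure ℝ≥0 => ⨆ k : ℕ, ∫⁻ x, truncatedPotential k x ∂(μ : Measure ℝ≥0) :=
    funext J_eq_iSup
  rw [h]
  refine lowerSemicontinuous_iSup fun k => Continuous.lowerSemicontinuous ?_
  refine continuous_iff_continuousAt.2 fun μ => ?_
  exact ProbabilityMeasure.tendsto_iff_forall_lintegral_tendsto.1 tendsto_id (truncatedPotential k)

theorem one_le_J (μ : ProbabilityMeasure ℝ≥0) : 1 ≤ J μ := by
  calc (1 : ℝ≥0∞) = ∫⁻ _, 1 ∂(μ : Measure ℝ≥0) := by simp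
    _ ≤ J μ := lintegral_mono one_le_potential

theorem J_diracProba_one : J (diracProba 1) = 1 := by
  rw [J]
  change ∫⁻ x, potential x ∂(Measure.dirac 1) = 1
  rw [lintegral_dirac, potential_one]

theorem iInf_J : ⨅ ν, J ν = 1 :=
  le_antisymm (J_diracProba_one ▸ iInf_le J (diracProba 1)) (le_iInf one_le_J)

theorem rate_eq (μ : ProbabilityMeasure ℝ≥0) : rate μ = J μ - 1 := by
  rw [rate, iInf_J]

theorem rate_add_one (μ : ProbabilityMeasure ℝ≥0) : rate μ + 1 = J μ := by
  rw [rate_eq, tsub_add_cancel_of_le (one_le_J μ)]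

/-- If J(μ) = 1, the nonnegative function V - 1 has integral zero, so V = 1 almost everywhere;
strictness of log y < y - 1 then puts all mass at 1. -/
theorem one_lt_J {μ : ProbabilityMeasure ℝ≥0} (hμ : μ ≠ diracProba 1) : 1 < J μ := by
  refine lt_of_le_of_ne (one_le_J μ) fun h => hμ ?_
  have hsub : ∫⁻ x, (potential x - 1) ∂(μ : Measure ℝ≥0) = 0 := by
    rw [lintegral_sub measurable_const (by simp) (ae_of_all _ one_le_potential)]
    change J μ - _ = 0
    rw [← h]
    simp
  have hm : Measurable fun x => potential x - 1 :=
    continuous_potential.measurable.sub measurable_const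
  rw [lintegral_eq_zero_iff hm] at hsub
  have hae : ∀ᵐ x ∂(μ : Measure ℝ≥0), x = 1 := by
    filter_upwards [hsub] with x hx
    exact eq_one_of_potential_le_one (tsub_eq_zero_iff_le.1 hx)
  refine Subtype.ext (Measure.ext fun A hA => ?_)
  change (μ : Measure ℝ≥0) A = Measure.dirac 1 A
  rw [Measure.dirac_apply' _ hA]
  by_cases h1 : (1 : ℝ≥0) ∈ A
  · rw [Set.indicator_of_mem h1, Pi.one_apply, prob_compl_eq_zero_iff hA |>.1]
    filter_upwards [hae] with x hx
    simpa [hx] using h1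
  · rw [Set.indicator_of_notMem h1]
    refine measure_mono_null (fun x hx => ?_) hae
    intro hx1
    exact h1 (hx1 ▸ hx)

theorem lowerSemicontinuous_rate : LowerSemicontinuous rate := by
  have h : rate = (fun a : ℝ≥0∞ => a - 1) ∘ J := funext rate_eq
  rw [h]
  exact (ENNReal.continuous_sub_right 1).comp_lowerSemicontinuous lowerSemicontinuous_J
    fun a b hab => tsub_le_tsub_right hab 1

/-- Markov's inequality: since x² ≤ 2V(x), the potential is at least L outside [0, 2L + 1]. -/
theorem isTightMeasureSet_J_le (M : ℝ≥0) :
    IsTightMeasureSet {((μ : ProbabilityMeasure ℝ≥0) : Measure ℝ≥0) | μ ∈ {μ | J μ ≤ M}} := by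
  rw [isTightMeasureSet_iff_exists_isCompact_measure_compl_le]
  intro ε hε
  obtain ⟨L, hL0, hL⟩ : ∃ L : ℝ≥0, L ≠ 0 ∧ (M : ℝ≥0∞) / L ≤ ε := by
    rcases eq_or_ne ε ⊤ with rfl | hε'
    · exact ⟨1, one_ne_zero, le_top⟩
    · lift ε to ℝ≥0 using hε'
      have hε0 : ε ≠ 0 := by simpa using hε.ne'
      refine ⟨M / ε + 1, by positivity, ?_⟩
      rw [← ENNReal.coe_div (by positivity), ENNReal.coe_le_coe, div_le_iff₀ (by positivity),
        mul_add, mul_div_cancel₀ _ hε0]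
      exact le_self_add
  refine ⟨Set.Icc 0 (2 * L + 1), isCompact_Icc, ?_⟩
  rintro _ ⟨μ, hμ, rfl⟩
  calc (μ : Measure ℝ≥0) (Set.Icc 0 (2 * L + 1))ᶜ
      ≤ (μ : Measure ℝ≥0) {x | (L : ℝ≥0∞) ≤ potential x} := by
        refine measure_mono fun x hx => ?_
        have hx' : 2 * L + 1 < x := by simpa using hx
        have hpos : 0 < x := lt_of_le_of_lt zero_le hx'
        have hxr : 2 * (L : ℝ) + 1 < x := by exact_mod_cast hx'
        change (L : ℝ≥0∞) ≤ potential x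
        rw [potential_of_pos hpos, ← ENNReal.ofReal_coe_nnreal]
        refine ENNReal.ofReal_le_ofReal ?_
        have := sq_le_two_mul_realPotential (x := x) (by exact_mod_cast hpos)
        nlinarith [L.coe_nonneg]
    _ ≤ J μ / L := meas_ge_le_lintegral_div continuous_potential.measurable.aemeasurable
        (by simpa using hL0) ENNReal.coe_ne_top
    _ ≤ M / L := ENNReal.div_le_div_right hμ _
    _ ≤ ε := hL

theorem isGood_rate : IsGood rate := by
  intro M
  have hset : {μ | rate μ ≤ M} = {μ | J μ ≤ ((M + 1 : ℝ≥0) : ℝ≥0∞)} := by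
    ext μ
    simp only [Set.mem_ofPred_eq]
    rw [rate_eq, tsub_le_iff_right]
    simp
  rw [hset]
  have hclosed : IsClosed {μ | J μ ≤ ((M + 1 : ℝ≥0) : ℝ≥0∞)} :=
    lowerSemicontinuous_J.isClosed_preimage _
  exact hclosed.closure_eq ▸ isCompact_closure_of_isTightMeasureSet (isTightMeasureSet_J_le (M + 1))

/-! ### Empirical measures and their convergence -/

theorem lintegral_empirical (p : ℕ+) (s : Fin p → ℝ) (f : ℝ≥0 → ℝ≥0∞) :
    ∫⁻ x, f x ∂(empirical p s : Measure ℝ≥0) =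
      ((p : ℕ) : ℝ≥0∞)⁻¹ * ∑ i, f (s i).toNNReal := by
  rw [empirical, ProbabilityMeasure.coe_mk, lintegral_smul_measure,
    lintegral_finsetSum_measure, smul_eq_mul]
  simp

theorem J_empirical_of_pos (p : ℕ+) {s : Fin p → ℝ} (hs : ∀ i, 0 < s i) :
    J (empirical p s) = ENNReal.ofReal ((∑ i, realPotential (s i)) / p) := by
  have hV : ∀ i, 0 ≤ realPotential (s i) := fun i => zero_le_one.trans (one_le_realPotential (hs i))
  have hp : (0 : ℝ) < ((p : ℕ) : ℝ) := by exact_mod_cast p.pos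
  rw [J, lintegral_empirical, div_eq_inv_mul, ENNReal.ofReal_mul (by positivity),
    ENNReal.ofReal_inv_of_pos hp, ENNReal.ofReal_natCast, ENNReal.ofReal_sum_of_nonneg fun i _ => hV i]
  congr 1
  refine Finset.sum_congr rfl fun i _ => ?_
  rw [potential_of_pos (Real.toNNReal_pos.2 (hs i)), Real.coe_toNNReal _ (hs i).le]

/-- The strong law of large numbers for a function of the coordinates of an i.i.d. sequence. -/
theorem ae_infinitePi_tendsto_average {X : Type*} [MeasurableSpace X] (μ : Measure X)
    [IsProbabilityMeasure μ] {g : X → ℝ} (hgm : Measurable g) (hg : Integrable g μ) :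
    ∀ᵐ ω ∂(Measure.infinitePi fun _ : ℕ => μ),
      Tendsto (fun n : ℕ => (∑ i ∈ Finset.range n, g (ω i)) / n) atTop (𝓝 (∫ x, g x ∂μ)) := by
  have hmp : ∀ i, MeasurePreserving (Function.eval i) (Measure.infinitePi fun _ : ℕ => μ) μ :=
    fun i => measurePreserving_eval_infinitePi (fun _ : ℕ => μ) i
  have hind := ProbabilityTheory.iIndepFun_infinitePi (P := fun _ : ℕ => μ) (X := fun _ => g)
    (fun _ => hgm)
  have h := ProbabilityTheory.strong_law_ae_real (μ := Measure.infinitePi fun _ : ℕ => μ)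
    (fun i ω => g (ω i)) ((hmp 0).integrable_comp_of_integrable hg)
    (fun i j hij => hind.indepFun hij)
    (fun i => by
      refine ⟨(hgm.comp (hmp i).measurable).aemeasurable,
        (hgm.comp (hmp 0).measurable).aemeasurable, ?_⟩
      have hi : Measure.map (fun ω : ℕ → X => g (ω i)) (Measure.infinitePi fun _ : ℕ => μ) =
          Measure.map g μ :=
        (Measure.map_map hgm (hmp i).measurable).symm.trans
          (congrArg (Measure.map g) (hmp i).map_eq)
      have h0 : Measure.map (fun ω : ℕ → X => g (ω 0)) (Measure.infinitePi fun _ : ℕ => μ) =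
          Measure.map g μ :=
        (Measure.map_map hgm (hmp 0).measurable).symm.trans
          (congrArg (Measure.map g) (hmp 0).map_eq)
      rw [hi, h0])
  have hint : ∫ ω, g (ω 0) ∂(Measure.infinitePi fun _ : ℕ => μ) = ∫ x, g x ∂μ := by
    rw [← (hmp 0).map_eq, integral_map (hmp 0).measurable.aemeasurable
      hgm.aestronglyMeasurable]
    rw [(hmp 0).map_eq]
  rwa [hint] at h

theorem integral_empirical (p : ℕ+) (s : Fin p → ℝ) (f : ℝ≥0 → ℝ) :
    ∫ x, f x ∂(empirical p s : Measure ℝ≥0) = (∑ i, f (s i).toNNReal) / p := by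
  rw [empirical, ProbabilityMeasure.coe_mk, integral_smul_measure,
    integral_finsetSum_measure fun i _ => integrable_dirac (by simp)]
  simp [div_eq_inv_mul]

theorem empirical_apply (p : ℕ+) (t : ℕ → ℝ≥0) {U : Set ℝ≥0} (hU : MeasurableSet U) :
    (empirical p fun i => (t i : ℝ) : Measure ℝ≥0) U =
      ENNReal.ofReal ((∑ i ∈ Finset.range p, U.indicator 1 (t i)) / (p : ℕ)) := by
  have hp : (0 : ℝ) < ((p : ℕ) : ℝ) := by exact_mod_cast p.pos
  rw [← lintegral_indicator_one hU, lintegral_empirical, Finset.sum_range, div_eq_inv_mul,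
    ENNReal.ofReal_mul (by positivity), ENNReal.ofReal_inv_of_pos hp, ENNReal.ofReal_natCast,
    ENNReal.ofReal_sum_of_nonneg fun i _ => Set.indicator_nonneg (by simp) _]
  congr 1
  refine Finset.sum_congr rfl fun i _ => ?_
  by_cases h : t i ∈ U <;> simp [h]

theorem empirical_comp_perm (p : ℕ+) (s : Fin p → ℝ) (σ : Equiv.Perm (Fin p)) :
    empirical p (s ∘ σ) = empirical p s := by
  refine Subtype.ext ?_
  change _ • _ = _ • _
  congr 1
  exact Equiv.sum_comp σ fun i => Measure.dirac (s i).toNNReal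

/-- Weak convergence of the empirical measures of a sequence which equidistributes with respect to
finite unions of basic open sets. -/
theorem tendsto_empirical_of_tendsto_average {μ : ProbabilityMeasure ℝ≥0} {b : ℕ → Set ℝ≥0}
    (hb : TopologicalSpace.IsTopologicalBasis (Set.range b)) {t : ℕ → ℝ≥0}
    (ht : ∀ F : Finset ℕ, Tendsto (fun n : ℕ =>
      (∑ i ∈ Finset.range n, (⋃ k ∈ F, b k).indicator (1 : ℝ≥0 → ℝ) (t i)) / n) atTop
        (𝓝 (∫ x, (⋃ k ∈ F, b k).indicator (1 : ℝ≥0 → ℝ) x ∂(μ : Measure ℝ≥0)))) :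
    Tendsto (fun p : ℕ+ => empirical p fun i => (t i : ℝ)) atTop (𝓝 μ) := by
  classical
  refine tendsto_of_forall_isOpen_le_liminf' fun G hG => ?_
  have hopen : ∀ k, IsOpen (b k) := fun k => hb.isOpen ⟨k, rfl⟩
  -- By the portmanteau theorem only open `G` matter. Finite unions of basic sets inside `G`
  -- increase to `G`, so convergence on each of them suffices.
  set F : ℕ → Finset ℕ := fun N => (Finset.range N).filter fun k => b k ⊆ G with hF
  set U : ℕ → Set ℝ≥0 := fun N => ⋃ k ∈ F N, b k with hU
  have hUm : ∀ N, MeasurableSet (U N) := fun N =>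
    (isOpen_biUnion fun k _ => hopen k).measurableSet
  have hmono : Monotone U := by
    intro M N hMN
    refine Set.biUnion_subset_biUnion_left fun k hk => ?_
    simp only [hF, Finset.coe_filter, Finset.mem_range, Set.mem_ofPred_eq] at hk ⊢
    exact ⟨hk.1.trans_le hMN, hk.2⟩
  have hUG : ∀ N, U N ⊆ G := fun N => Set.iUnion₂_subset fun k hk => (Finset.mem_filter.1 hk).2
  have hunion : ⋃ N, U N = G := by
    refine Set.Subset.antisymm (Set.iUnion_subset hUG) fun x hx => ?_
    obtain ⟨_, ⟨k, rfl⟩, hxk, hkG⟩ := hb.exists_subset_of_mem_open hx hG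
    refine Set.mem_iUnion.2 ⟨k + 1, Set.mem_iUnion₂.2 ⟨k, ?_, hxk⟩⟩
    simp [hF, hkG]
  have hlim := tendsto_measure_iUnion_atTop (μ := (μ : Measure ℝ≥0)) hmono
  rw [hunion] at hlim
  refine le_of_tendsto' hlim fun N => ?_
  have hN : Tendsto (fun p : ℕ+ => (empirical p fun i => (t i : ℝ) : Measure ℝ≥0) (U N)) atTop
      (𝓝 ((μ : Measure ℝ≥0) (U N))) := by
    simp only [empirical_apply _ _ (hUm N)]
    have h := ENNReal.tendsto_ofReal ((ht (F N)).comp tendsto_PNat_val_atTop_atTop)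
    rw [show ∫ x, (⋃ k ∈ F N, b k).indicator (1 : ℝ≥0 → ℝ) x ∂(μ : Measure ℝ≥0) =
      (μ : Measure ℝ≥0).real (U N) from integral_indicator_one (hUm N),
      ofReal_measureReal (measure_ne_top _ _)] at h
    exact h
  change (μ : Measure ℝ≥0) (U N) ≤ _
  rw [← hN.liminf_eq]
  exact liminf_le_liminf (Eventually.of_forall fun p => measure_mono (hUG N))

/-- A sequence of positive numbers whose empirical measures converge weakly to `μ` along with the
averages of the potential. -/
theorem exists_seq_tendsto_empirical (μ : ProbabilityMeasure ℝ≥0) (hμ : J μ ≠ ⊤) :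
    ∃ t : ℕ → ℝ≥0, (∀ i, 0 < t i) ∧
      Tendsto (fun p : ℕ+ => empirical p fun i => (t i : ℝ)) atTop (𝓝 μ) ∧
      Tendsto (fun p : ℕ+ => (∑ i : Fin p, realPotential (t i)) / (p : ℕ)) atTop
        (𝓝 (J μ).toReal) := by
  obtain ⟨v, hv, -⟩ := (TopologicalSpace.isBasis_countableBasis ℝ≥0).exists_subset_of_mem_open
    (Set.mem_univ 0) isOpen_univ
  obtain ⟨b, hb⟩ := (TopologicalSpace.countable_countableBasis ℝ≥0).exists_eq_range ⟨v, hv⟩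
  have hbasis : TopologicalSpace.IsTopologicalBasis (Set.range b) :=
    hb ▸ TopologicalSpace.isBasis_countableBasis ℝ≥0
  have hpm := continuous_potential.measurable
  have h1 := ae_infinitePi_tendsto_average (μ : Measure ℝ≥0) hpm.ennreal_toReal
    (integrable_toReal_of_lintegral_ne_top hpm.aemeasurable hμ)
  -- There are countably many finite unions, so a single null set serves them all.
  have h2 : ∀ᵐ ω ∂(Measure.infinitePi fun _ : ℕ => (μ : Measure ℝ≥0)), ∀ F : Finset ℕ,
      Tendsto (fun n : ℕ =>
        (∑ i ∈ Finset.range n, (⋃ k ∈ F, b k).indicator (1 : ℝ≥0 → ℝ) (ω i)) / n) atTop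
        (𝓝 (∫ x, (⋃ k ∈ F, b k).indicator (1 : ℝ≥0 → ℝ) x ∂(μ : Measure ℝ≥0))) := by
    refine ae_all_iff.2 fun F => ?_
    have hm : MeasurableSet (⋃ k ∈ F, b k) :=
      (isOpen_biUnion fun k _ => hbasis.isOpen ⟨k, rfl⟩).measurableSet
    exact ae_infinitePi_tendsto_average _ (measurable_one.indicator hm)
      ((integrable_const (1 : ℝ)).indicator hm)
  have h3 : ∀ᵐ ω ∂(Measure.infinitePi fun _ : ℕ => (μ : Measure ℝ≥0)), ∀ i : ℕ, 0 < ω i := by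
    refine ae_all_iff.2 fun i => ?_
    refine (measurePreserving_eval_infinitePi (fun _ : ℕ => (μ : Measure ℝ≥0)) i).quasiMeasurePreserving.ae
      (p := fun x => 0 < x) ?_
    -- Finiteness of J(μ) excludes an atom at 0, where the potential is infinite.
    filter_upwards [ae_lt_top hpm hμ] with x hx
    refine pos_iff_ne_zero.2 ?_
    rintro rfl
    simp [potential] at hx
  obtain ⟨t, ht1, ht2, ht3⟩ := (h1.and (h2.and h3)).exists
  refine ⟨t, ht3, tendsto_empirical_of_tendsto_average hbasis ht2, ?_⟩
  rw [integral_toReal hpm.aemeasurable (ae_lt_top hpm hμ)] at ht1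
  refine (ht1.comp tendsto_PNat_val_atTop_atTop).congr fun p => ?_
  simp only [Function.comp_apply, Finset.sum_range]
  congr 1
  refine Finset.sum_congr rfl fun i _ => ?_
  rw [potential_of_pos (ht3 i), ENNReal.toReal_ofReal]
  exact zero_le_one.trans (one_le_realPotential (by exact_mod_cast ht3 i))

/-- Lipschitz test functions determine weak convergence, and their averages move by at most L η. -/
theorem tendsto_empirical_of_abs_sub_le {μ : ProbabilityMeasure ℝ≥0} {s t : ∀ p : ℕ+, Fin p → ℝ}
    {η : ℕ+ → ℝ} (hη : Tendsto η atTop (𝓝 0)) (hst : ∀ᶠ p in atTop, ∀ i, |s p i - t p i| ≤ η p)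
    (ht : Tendsto (fun p => empirical p (t p)) atTop (𝓝 μ)) :
    Tendsto (fun p => empirical p (s p)) atTop (𝓝 μ) := by
  rw [tendsto_iff_forall_lipschitz_integral_tendsto] at ht ⊢
  rintro f hf ⟨L, hL⟩
  refine (tendsto_iff_of_dist ?_).1 (ht f hf ⟨L, hL⟩)
  refine squeeze_zero' (Eventually.of_forall fun _ => dist_nonneg) ?_
    (show Tendsto (fun p => L * η p) atTop (𝓝 0) by simpa using hη.const_mul (L : ℝ))
  filter_upwards [hst] with p hp
  have hpos : (0 : ℝ) < ((p : ℕ) : ℝ) := by exact_mod_cast p.pos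
  rw [integral_empirical, integral_empirical, Real.dist_eq, ← sub_div, ← Finset.sum_sub_distrib,
    abs_div, abs_of_pos hpos, div_le_iff₀ hpos]
  calc |∑ i, (f (t p i).toNNReal - f (s p i).toNNReal)|
      ≤ ∑ i, |f (t p i).toNNReal - f (s p i).toNNReal| := Finset.abs_sum_le_sum_abs _ _
    _ ≤ ∑ _i : Fin p, L * η p := by
        refine Finset.sum_le_sum fun i _ => ?_
        have h1 := hL.dist_le_mul (t p i).toNNReal (s p i).toNNReal
        have h2 := Real.lipschitzWith_toNNReal.dist_le_mul (t p i) (s p i)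
        rw [Real.dist_eq, NNReal.coe_one, one_mul, abs_sub_comm (t p i)] at h2
        rw [Real.dist_eq] at h1
        exact h1.trans (mul_le_mul_of_nonneg_left (h2.trans (hp i)) L.coe_nonneg)
    _ = L * η p * (p : ℕ) := by
        rw [Finset.sum_const, Finset.card_univ, Fintype.card_fin, nsmul_eq_mul, mul_comm]

/-! ### Logarithmic asymptotics and the large deviation bounds -/

theorem limsup_log_div_le {ι : Type*} {l : Filter ι} [l.NeBot] {P : ι → ℝ≥0∞} {a u : ι → ℝ} {c : ℝ}
    (ha : ∀ i, 0 ≤ a i) (h : ∀ᶠ i in l, P i ≤ ENNReal.ofReal (Real.exp (u i)))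
    (hu : Tendsto (fun i => u i / a i) l (𝓝 c)) :
    limsup (fun i => ENNReal.log (P i) / (a i : EReal)) l ≤ c := by
  rw [← ((continuous_coe_real_ereal.tendsto c).comp hu).limsup_eq]
  refine limsup_le_limsup ?_
  filter_upwards [h] with i hi
  have hlog := ENNReal.log_le_log hi
  rw [ENNReal.log_ofReal_of_pos (Real.exp_pos _), Real.log_exp] at hlog
  rw [Function.comp_apply, EReal.coe_div]
  exact EReal.div_le_div_right_of_nonneg (EReal.coe_nonneg.2 (ha i)) hlog

theorem le_liminf_log_div {ι : Type*} {l : Filter ι} [l.NeBot] {P : ι → ℝ≥0∞} {a u : ι → ℝ} {c : ℝ}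
    (ha : ∀ i, 0 ≤ a i) (h : ∀ᶠ i in l, ENNReal.ofReal (Real.exp (u i)) ≤ P i)
    (hu : Tendsto (fun i => u i / a i) l (𝓝 c)) :
    c ≤ liminf (fun i => ENNReal.log (P i) / (a i : EReal)) l := by
  rw [← ((continuous_coe_real_ereal.tendsto c).comp hu).liminf_eq]
  refine liminf_le_liminf ?_
  filter_upwards [h] with i hi
  have hlog := ENNReal.log_le_log hi
  rw [ENNReal.log_ofReal_of_pos (Real.exp_pos _), Real.log_exp] at hlog
  rw [Function.comp_apply, EReal.coe_div]
  exact EReal.div_le_div_right_of_nonneg (EReal.coe_nonneg.2 (ha i)) hlog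

theorem inv_mul_le_ofReal_exp_sub {Z I : ℝ≥0∞} {u l : ℝ} (hI : I ≤ ENNReal.ofReal (Real.exp u))
    (hZ : ENNReal.ofReal (Real.exp l) ≤ Z) : Z⁻¹ * I ≤ ENNReal.ofReal (Real.exp (u - l)) := by
  rw [sub_eq_neg_add, Real.exp_add, Real.exp_neg, ENNReal.ofReal_mul (by positivity),
    ENNReal.ofReal_inv_of_pos (Real.exp_pos _)]
  exact mul_le_mul' (ENNReal.inv_le_inv.2 hZ) hI

theorem ofReal_exp_sub_le_inv_mul {Z I : ℝ≥0∞} {u l : ℝ} (hI : ENNReal.ofReal (Real.exp l) ≤ I)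
    (hZ : Z ≤ ENNReal.ofReal (Real.exp u)) : ENNReal.ofReal (Real.exp (l - u)) ≤ Z⁻¹ * I := by
  rw [sub_eq_neg_add, Real.exp_add, Real.exp_neg, ENNReal.ofReal_mul (by positivity),
    ENNReal.ofReal_inv_of_pos (Real.exp_pos _)]
  exact mul_le_mul' (ENNReal.inv_le_inv.2 hZ) hI

/-- The logarithm of an upper bound for the unnormalized mass of configurations whose potential
averages to at least `c`. -/
def upperExponent (p n : ℕ) (c : ℝ) : ℝ := -(((n : ℝ) - 30 * p) * (p * c))

theorem normConst_le {p n : ℕ} (hp : 1 ≤ p) (hn : 30 * p ≤ n) :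
    normConst p n ≤ ENNReal.ofReal (Real.exp (upperExponent p n 1)) := by
  rw [normConst, ← setLIntegral_univ]
  refine setLIntegral_density_le hp hn _ _ fun s _ hs => ?_
  calc (p : ℝ) * 1 = ∑ _i : Fin p, (1 : ℝ) := by simp
    _ ≤ _ := Finset.sum_le_sum fun i _ => one_le_realPotential (hs i)

theorem law_preimage_le {p n : ℕ+} (hn : 30 * (p : ℕ) ≤ n) {c : ℝ}
    {F : Set (ProbabilityMeasure ℝ≥0)} (hF : ∀ μ ∈ F, ENNReal.ofReal c ≤ J μ) :
    law p n (empirical p ⁻¹' F) ≤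
      ENNReal.ofReal (Real.exp (upperExponent p n c - lowerExponent p n p)) := by
  have hp : 1 ≤ (p : ℕ) := p.pos
  rw [law_apply]
  refine inv_mul_le_ofReal_exp_sub (setLIntegral_density_le hp hn _ _ fun s hsF hs => ?_)
    (ofReal_exp_lowerExponent_le_normConst hp (by omega))
  have h := hF _ hsF
  have hp' : (0 : ℝ) < ((p : ℕ) : ℝ) := by exact_mod_cast p.pos
  have hsum : 0 ≤ (∑ i, realPotential (s i)) / (p : ℕ) := div_nonneg
    (Finset.sum_nonneg fun i _ => zero_le_one.trans (one_le_realPotential (hs i))) hp'.le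
  rwa [J_empirical_of_pos p hs, ENNReal.ofReal_le_ofReal_iff hsum, le_div_iff₀ hp', mul_comm] at h

section Asymptotics

variable {n : ℕ+ → ℕ+}

theorem tendsto_speed (n : ℕ+ → ℕ+) :
    Tendsto (fun p : ℕ+ => ((p : ℕ) : ℝ) * ((n p : ℕ) : ℝ)) atTop atTop := by
  refine tendsto_atTop_mono (fun p => ?_)
    (tendsto_natCast_atTop_atTop.comp tendsto_PNat_val_atTop_atTop)
  have : (1 : ℝ) ≤ ((n p : ℕ) : ℝ) := by exact_mod_cast (n p).pos
  exact le_mul_of_one_le_right (Nat.cast_nonneg _) this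

theorem eventually_mul_le
    (hn : Tendsto (fun p : ℕ+ => ((p : ℕ) : ℝ) / ((n p : ℕ) : ℝ)) atTop (𝓝 0)) :
    ∀ᶠ p : ℕ+ in atTop, 30 * (p : ℕ) ≤ (n p : ℕ) := by
  filter_upwards [hn.eventually (gt_mem_nhds (show (0 : ℝ) < 1 / 30 by norm_num))] with p hp
  have hpos : (0 : ℝ) < ((n p : ℕ) : ℝ) := by exact_mod_cast (n p).pos
  rw [div_lt_iff₀ hpos] at hp
  have : (30 : ℝ) * ((p : ℕ) : ℝ) ≤ ((n p : ℕ) : ℝ) := by linarith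
  exact_mod_cast this

theorem tendsto_upperExponent_div
    (hn : Tendsto (fun p : ℕ+ => ((p : ℕ) : ℝ) / ((n p : ℕ) : ℝ)) atTop (𝓝 0)) (c : ℝ) :
    Tendsto (fun p : ℕ+ => upperExponent p (n p) c / (((p : ℕ) : ℝ) * ((n p : ℕ) : ℝ))) atTop
      (𝓝 (-c)) := by
  have h : Tendsto (fun p : ℕ+ => -((1 - 30 * (((p : ℕ) : ℝ) / ((n p : ℕ) : ℝ))) * c)) atTop
      (𝓝 (-((1 - 30 * 0) * c))) := ((tendsto_const_nhds.sub (hn.const_mul 30)).mul_const c).neg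
  rw [mul_zero, sub_zero, one_mul] at h
  refine h.congr fun p => ?_
  have hp : ((p : ℕ) : ℝ) ≠ 0 := by exact_mod_cast p.ne_zero
  have hnp : ((n p : ℕ) : ℝ) ≠ 0 := by exact_mod_cast (n p).ne_zero
  rw [upperExponent]
  field_simp

theorem tendsto_lowerExponent_div
    (hn : Tendsto (fun p : ℕ+ => ((p : ℕ) : ℝ) / ((n p : ℕ) : ℝ)) atTop (𝓝 0)) {S : ℕ+ → ℝ} {c : ℝ}
    (hS : Tendsto (fun p : ℕ+ => S p / (p : ℕ)) atTop (𝓝 c)) :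
    Tendsto (fun p : ℕ+ => lowerExponent p (n p) (S p) / (((p : ℕ) : ℝ) * ((n p : ℕ) : ℝ))) atTop
      (𝓝 (-c)) := by
  have hntop : Tendsto (fun p : ℕ+ => ((n p : ℕ) : ℝ)) atTop atTop := by
    refine tendsto_atTop_mono' _ ?_
      (tendsto_natCast_atTop_atTop.comp tendsto_PNat_val_atTop_atTop)
    filter_upwards [eventually_mul_le hn] with p hp
    have : (p : ℕ) ≤ n p := by omega
    simpa using this
  have hlog : Tendsto (fun p : ℕ+ => Real.log ((n p : ℕ) : ℝ) / ((n p : ℕ) : ℝ)) atTop (𝓝 0) :=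
    Real.isLittleO_log_id_atTop.tendsto_div_nhds_zero.comp hntop
  -- The Vandermonde cost divided by pn contains (p/n) log(n/p), which vanishes because x log x → 0
  -- at 0.
  have hent := (Real.continuous_negMulLog.tendsto 0).comp hn
  rw [Real.negMulLog_zero] at hent
  have h := ((hlog.neg).sub ((hent.add hn).const_mul 4)).sub
    (((tendsto_const_nhds (x := (1 : ℝ))).add (hn.const_mul 2)).mul
      (((tendsto_const_nhds (x := (1 : ℝ))).add (hn.const_mul 10)).mul hS))
  norm_num at h
  refine h.congr fun p => ?_
  have hp : ((p : ℕ) : ℝ) ≠ 0 := by exact_mod_cast p.ne_zero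
  have hnp : ((n p : ℕ) : ℝ) ≠ 0 := by exact_mod_cast (n p).ne_zero
  rw [lowerExponent, Real.negMulLog, Real.log_div hp hnp, Real.log_div hnp hp]
  field_simp
  ring

theorem limsup_log_law_le
    (hn : Tendsto (fun p : ℕ+ => ((p : ℕ) : ℝ) / ((n p : ℕ) : ℝ)) atTop (𝓝 0)) {r : ℝ≥0}
    {F : Set (ProbabilityMeasure ℝ≥0)} (hF : ∀ μ ∈ F, (r : ℝ≥0∞) ≤ rate μ) :
    limsup (fun p : ℕ+ => ENNReal.log (law p (n p) (empirical p ⁻¹' F)) /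
      (((p : ℕ) : ℝ) * ((n p : ℕ) : ℝ) : ℝ)) atTop ≤ ((-(r : ℝ) : ℝ) : EReal) := by
  refine limsup_log_div_le (u := fun p : ℕ+ => upperExponent p (n p) (r + 1) -
    lowerExponent p (n p) (p : ℕ)) (fun p => by positivity) ?_ ?_
  · filter_upwards [eventually_mul_le hn] with p hp
    refine law_preimage_le hp fun μ hμ => ?_
    rw [← rate_add_one, ENNReal.ofReal_add r.coe_nonneg zero_le_one, ENNReal.ofReal_coe_nnreal,
      ENNReal.ofReal_one]
    gcongr
    exact hF μ hμ
  · have h1 : Tendsto (fun p : ℕ+ => ((p : ℕ) : ℝ) / ((p : ℕ) : ℝ)) atTop (𝓝 1) :=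
      tendsto_const_nhds.congr fun p => (div_self (by exact_mod_cast p.ne_zero)).symm
    have h := (tendsto_upperExponent_div hn (r + 1)).sub (tendsto_lowerExponent_div hn h1)
    simp only [← sub_div] at h
    convert h using 2
    ring

theorem eventually_separatedBox_subset
    (hn : Tendsto (fun p : ℕ+ => ((p : ℕ) : ℝ) / ((n p : ℕ) : ℝ)) atTop (𝓝 0))
    {μ : ProbabilityMeasure ℝ≥0} {t : ∀ p : ℕ+, Fin p → ℝ}
    (ht : Tendsto (fun p => empirical p (t p)) atTop (𝓝 μ))
    {O : Set (ProbabilityMeasure ℝ≥0)} (hO : IsOpen O) (hμ : μ ∈ O) :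
    ∀ᶠ p in atTop, separatedBox (n p) (t p) ⊆ empirical p ⁻¹' O := by
  classical
  -- Selecting a bad point in each box whenever one exists turns the uniform claim into convergence
  -- of one sequence: the selected points stay within 2p/n of `t`, so their empirical measures tend
  -- to μ and eventually lie in `O`.
  let bad : ∀ p : ℕ+, Set (Fin p → ℝ) := fun p => separatedBox (n p) (t p) \ empirical p ⁻¹' O
  let s : ∀ p : ℕ+, Fin p → ℝ := fun p => if h : (bad p).Nonempty then h.some else t p
  have hs : Tendsto (fun p => empirical p (s p)) atTop (𝓝 μ) := by
    refine tendsto_empirical_of_abs_sub_le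
      (η := fun p => 2 * (((p : ℕ) : ℝ) / ((n p : ℕ) : ℝ))) (by simpa using hn.const_mul 2)
      (Eventually.of_forall fun p i => ?_) ht
    by_cases h : (bad p).Nonempty
    · have hmem : s p ∈ separatedBox (n p) (t p) := by
        simp only [s, dif_pos h]
        exact h.some_mem.1
      have h1 := le_of_mem_separatedBox hmem i
      have h2 := le_add_of_mem_separatedBox hmem i
      rw [mul_div_assoc] at h2
      rw [abs_of_nonneg (by linarith)]
      linarith
    · simp only [s, dif_neg h, sub_self, abs_zero]
      positivity
  filter_upwards [hs.eventually (hO.mem_nhds hμ)] with p hp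
  by_contra hsub
  have h : (bad p).Nonempty := Set.sdiff_nonempty.2 hsub
  simp only [s, dif_pos h] at hp
  exact h.some_mem.2 hp

theorem le_liminf_log_law
    (hn : Tendsto (fun p : ℕ+ => ((p : ℕ) : ℝ) / ((n p : ℕ) : ℝ)) atTop (𝓝 0))
    {O : Set (ProbabilityMeasure ℝ≥0)} (hO : IsOpen O) {μ : ProbabilityMeasure ℝ≥0} (hμ : μ ∈ O) :
    -((rate μ : ℝ≥0∞) : EReal) ≤
      liminf (fun p : ℕ+ => ENNReal.log (law p (n p) (empirical p ⁻¹' O)) /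
        (((p : ℕ) : ℝ) * ((n p : ℕ) : ℝ) : ℝ)) atTop := by
  by_cases hJ : J μ = ⊤
  · rw [rate_eq, hJ]
    simp
  obtain ⟨t, htpos, htμ, htV⟩ := exists_seq_tendsto_empirical μ hJ
  -- The separated box requires a monotone configuration; sorting changes neither the empirical
  -- measure nor the sum of the potential.
  let τ : ∀ p : ℕ+, Fin p → ℝ := fun p =>
    (fun i : Fin p => (t i : ℝ)) ∘ Tuple.sort (fun i : Fin p => (t i : ℝ))
  have hτpos : ∀ p i, 0 < τ p i := fun p i => by exact_mod_cast htpos _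
  have hτmono : ∀ p, Monotone (τ p) := fun p => Tuple.monotone_sort _
  have hτsum : ∀ p, ∑ i, realPotential (τ p i) = ∑ i : Fin p, realPotential (t i) := fun p =>
    Equiv.sum_comp (Tuple.sort (fun i : Fin p => (t i : ℝ))) fun i => realPotential (t i)
  have hτμ : Tendsto (fun p => empirical p (τ p)) atTop (𝓝 μ) :=
    htμ.congr fun p => (empirical_comp_perm p _ _).symm
  have hrate : rate μ = ENNReal.ofReal ((J μ).toReal - 1) := by
    rw [rate_eq, ENNReal.ofReal_sub _ zero_le_one, ENNReal.ofReal_toReal hJ, ENNReal.ofReal_one]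
  have hJ1 : 0 ≤ (J μ).toReal - 1 := by
    rw [sub_nonneg, ← ENNReal.toReal_one]
    exact ENNReal.toReal_mono hJ (one_le_J μ)
  rw [hrate, EReal.coe_ennreal_ofReal, max_eq_left hJ1, ← EReal.coe_neg]
  refine le_liminf_log_div (u := fun p : ℕ+ => lowerExponent p (n p) (∑ i : Fin p, realPotential (t i)) -
    upperExponent p (n p) 1) (fun p => by positivity) ?_ ?_
  · filter_upwards [eventually_mul_le hn, eventually_separatedBox_subset hn hτμ hO hμ] with p hp hsub
    have hp1 : 1 ≤ (p : ℕ) := p.pos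
    rw [law_apply, ← hτsum p]
    refine ofReal_exp_sub_le_inv_mul ?_ (normConst_le hp1 hp)
    exact (ofReal_exp_lowerExponent_le hp1 (by omega) (hτpos p) (hτmono p)).trans
      (lintegral_mono_set hsub)
  · have h := (tendsto_lowerExponent_div hn htV).sub (tendsto_upperExponent_div hn 1)
    simp only [← sub_div] at h
    convert h using 2
    ring

theorem satisfiesLDP
    (hn : Tendsto (fun p : ℕ+ => ((p : ℕ) : ℝ) / ((n p : ℕ) : ℝ)) atTop (𝓝 0)) :
    SatisfiesLDP atTop (fun p : ℕ+ => law p (n p)) (fun p : ℕ+ => empirical p)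
      (fun p : ℕ+ => ((p : ℕ) : ℝ) * ((n p : ℕ) : ℝ)) rate where
  speed := tendsto_speed n
  lowerSemicontinuous := lowerSemicontinuous_rate
  lower_bound O hO := by
    rw [EReal.neg_le]
    -- Truncating the negated liminf below at 0 moves the comparison into [0, ∞], where it can be
    -- checked against each μ in `O`.
    refine (EReal.coe_toENNReal_eq_max.symm ▸ le_max_right _ _).trans (EReal.coe_ennreal_le_coe_ennreal_iff.2 ?_)
    refine le_iInf₂ fun μ hμ => ?_
    have h := EReal.toENNReal_le_toENNReal (EReal.neg_le.1 (le_liminf_log_law hn hO hμ))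
    rwa [EReal.toENNReal_coe] at h
  upper_bound F _ := by
    -- Real levels z above -inf I also cover an infinite infimum; the rate bound used is r = max(-z,
    -- 0).
    refine EReal.le_of_forall_lt_iff_le.1 fun z hz => ?_
    have hz' : ((Real.toNNReal (-z) : ℝ≥0) : ℝ≥0∞) ≤ ⨅ μ ∈ F, rate μ := by
      rw [← EReal.coe_ennreal_le_coe_ennreal_iff]
      change ((ENNReal.ofReal (-z) : ℝ≥0∞) : EReal) ≤ _
      rw [EReal.coe_ennreal_ofReal, EReal.coe_strictMono.monotone.map_max]
      refine max_le ?_ (EReal.coe_ennreal_nonneg _)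
      rw [EReal.coe_neg]
      exact (EReal.neg_lt_comm.1 hz).le
    refine (limsup_log_law_le hn fun μ hμ => hz'.trans (iInf₂_le μ hμ)).trans ?_
    rw [EReal.coe_le_coe_iff, Real.coe_toNNReal']
    linarith [le_max_left (-z) 0]

end Asymptotics

end WishartLDP

end

theorem proposition2p1 :
    (∀ p n : ℕ+, p ≤ n → IsProbabilityMeasure (WishartLDP.law p n)) ∧
    (∀ n : ℕ+ → ℕ+,
      Tendsto (fun p : ℕ+ => ((p : ℕ) : ℝ) / ((n p : ℕ) : ℝ)) atTop (𝓝 0) →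
      WishartLDP.SatisfiesLDP atTop (fun p : ℕ+ => WishartLDP.law p (n p))
        (fun p : ℕ+ => WishartLDP.empirical p)
        (fun p : ℕ+ => ((p : ℕ) : ℝ) * ((n p : ℕ) : ℝ)) WishartLDP.rate) ∧
    WishartLDP.IsGood WishartLDP.rate ∧
    (WishartLDP.J (diracProba 1) = 1 ∧
      ∀ μ : ProbabilityMeasure ℝ≥0, μ ≠ diracProba 1 → 1 < WishartLDP.J μ) := by
  exact ⟨fun p n hpn => WishartLDP.isProbabilityMeasure_law p.pos hpn,
    fun _ hn => WishartLDP.satisfiesLDP hn, WishartLDP.isGood_rate,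
    WishartLDP.J_diracProba_one, fun _ => WishartLDP.one_lt_J⟩
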